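/- By a semiring we mean a commutative semiring with $0$ and $1$. A preordered semiring $(S,\preccurlyeq)$ is a semiring $S$ with a reflexive and transitive relation $\preccurlyeq$ such that $0\preccurlyeq 1$ and such that $a\preccurlyeq b$ implies $a+c\preccurlyeq b+c$ and $ac\preccurlyeq bc$. Its spectrum $\Delta(S,\preccurlyeq)$ is the set of semiring homomorphisms $f:S\to\mathbb{R}_{\ge 0}$ (preserving $0$, $1$, $+$, $\cdot$) that are monotone ($a\preccurlyeq b\Rightarrow f(a)\le f(b)$), with the initial topology with respect to the evaluation maps $\mathrm{ev}_s:f\mapsto f(s)$, $s\in S$. An element $u\in S$ is power universal if for every $x\in S\setminus\{0\}$ there is a $k\in\mathbb{N}$ with $1\preccurlyeq u^kx$ and $x\preccurlyeq u^k$; $S$ is of polynomial growth if it has a power universal element. For a power universal $u$, the asymptotic preorder is defined by: $x\succsim y$ iff there is a sequence $(k_n)_{n\in\mathbb{N}}$ of nonnegative integers with $k_n/n\to 0$ and $y^n\preccurlyeq u^{k_n}x^n$ for all $n\in\mathbb{N}$. Theorem. Let $(S,\preccurlyeq)$ be a preordered semiring of polynomial growth such that the canonical map $\mathbb{N}\to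 S$ is an order embedding (for $a,b\in\mathbb{N}$, $a\preccurlyeq b$ in $S$ iff $a\le b$). Let $M\subseteq S$ and let $S_0$ be the subsemiring generated by $M$, with the restricted preorder. Suppose that (M1) for all $s\in S\setminus\{0\}$ there exist $m\in M$ and $n\in\mathbb{N}$ such that $1\preccurlyeq nms$ and $ms\preccurlyeq n$; (M2) for all $m\in M$ such that $\mathrm{ev}_m:\Delta(S_0,\preccurlyeq)\to\mathbb{R}_{\ge 0}$ is bounded there is an $n\in\mathbb{N}$ such that $m\preccurlyeq n$. Then, whichever power universal element $u$ is used to define $\succsim$, for all $x,y\in S$ $$x\succsim y\iff \forall f\in\Delta(S,\preccurlyeq):\ f(x)\ge f(y).$$ Moreover, $\Delta(S,\preccurlyeq)$ is a nonempty locally compact Hausdorff space, and for every power universal $u\in S$ the map $\mathrm{ev}_u:\Delta(S,\preccurlyeq)\to\mathbb{R}_{\ge 0}$ is proper. -/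

import Mathlib

open scoped NNReal

/-- A relation `≼` making the commutative unital semiring `S` a preordered semiring. It is bundled as
data, so that one semiring may carry several preorders. -/
structure SemiringPreorder (S : Type*) [CommSemiring S] where
  /-- `P.le a b` means `a ≼ b`. -/
  le : S → S → Prop
  refl : ∀ a, le a a
  trans : ∀ a b c, le a b → le b c → le a c
  zero_le_one : le 0 1
  add_right : ∀ a b c, le a b → le (a + c) (b + c)
  mul_right : ∀ a b c, le a b → le (a * c) (b * c)

namespace SemiringPreorder

/-- The restriction of the preorder to a subsemiring. -/
def restrict {S : Type*} [CommSemiring S] (P : SemiringPreorder S) (S₀ : Subsemiring S) :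
    SemiringPreorder S₀ where
  le a b := P.le (a : S) (b : S)
  refl a := P.refl a
  trans a b c := P.trans a b c
  zero_le_one := P.zero_le_one
  add_right a b c := P.add_right a b c
  mul_right a b c := P.mul_right a b c

/-- `u` is power universal: each nonzero `x` satisfies `1 ≼ u ^ k * x` and `x ≼ u ^ k` for some `k`. -/
def IsPowerUniversal {S : Type*} [CommSemiring S] (P : SemiringPreorder S) (u : S) : Prop :=
  ∀ x : S, x ≠ 0 → ∃ k : ℕ, P.le 1 (u ^ k * x) ∧ P.le x (u ^ k)

/-- `S` is of polynomial growth if it has a power universal element. -/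
def PolynomialGrowth {S : Type*} [CommSemiring S] (P : SemiringPreorder S) : Prop :=
  ∃ u : S, P.IsPowerUniversal u

/-- The canonical map `ℕ → S` is an order embedding. -/
def NatOrderEmbedding {S : Type*} [CommSemiring S] (P : SemiringPreorder S) : Prop :=
  ∀ a b : ℕ, P.le (a : S) (b : S) ↔ a ≤ b

/-- `P.AsymptoticGE u x y` means `x ≿ y`, with respect to the power universal element `u`: there is a
sublinear sequence `k` of natural numbers with `y ^ n ≼ u ^ (k n) * x ^ n` for all `n`. -/
def AsymptoticGE {S : Type*} [CommSemiring S] (P : SemiringPreorder S) (u x y : S) : Prop :=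
  ∃ k : ℕ → ℕ, Filter.Tendsto (fun n : ℕ => (k n : ℝ) / (n : ℝ)) Filter.atTop (nhds 0) ∧
    ∀ n : ℕ, P.le (y ^ n) (u ^ k n * x ^ n)

/-- The set `Δ(S, ≼)` of monotone semiring homomorphisms `S → ℝ≥0`. -/
def Spectrum {S : Type*} [CommSemiring S] (P : SemiringPreorder S) : Type _ :=
  {f : S →+* ℝ≥0 // ∀ a b : S, P.le a b → f a ≤ f b}

/-- The evaluation map `Δ(S, ≼) → ℝ≥0`, `f ↦ f s`. -/
def ev {S : Type*} [CommSemiring S] (P : SemiringPreorder S) (s : S) (f : P.Spectrum) : ℝ≥0 :=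
  f.1 s

/-- The initial topology with respect to all evaluation maps. -/
instance Spectrum.instTopologicalSpace {S : Type*} [CommSemiring S] (P : SemiringPreorder S) : TopologicalSpace P.Spectrum :=
  ⨅ s : S, TopologicalSpace.induced (P.ev s) inferInstance

end SemiringPreorder

/-! Suppose first that every nonzero element lies between positive rationals. A maximal extension of
the preorder without `n + 1 ≼ n` is nearly total, so each element defines a Dedekind cut of
rationals, and its value is a monotone homomorphism (`exists_spectrum_of_dichotomy`). Adjoining a
reversed inequality beforehand gives Strassen's theorem `IsProper.exists_mul_le_of_ev_le`: an
inequality on the spectrum holds in the semiring up to a common factor `z` and a constant near 1.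
The factor is a catalyst, since one copy of it serves for all powers.

In general, put `U = 1 + u` and let `v ∈ M` be its inverse up to rational factors. Strassen's
theorem applies to `boundedPart`. A point of its spectrum either kills `v` or, by localizing at `v`,
comes from `Δ(S)` (`exists_bddHom`). Inequalities are therefore arranged so that a factor `v` makes
the points of the first kind harmless.

This is used twice. By `ev_restrict_le`, a bound on `Δ(S)` passes to `Δ(S₀)`, so (M2) yields that
every element bounded on `Δ(S)` is dominated by an integer (`bddElem_of_forall_ev_le`). By
`exists_pow_mul_le`, if `f y ≤ f x` on `Δ(S)`, then `y ^ N ≼ U ^ H * x ^ N` up to a catalyst, with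
`H` independent of `N`; a large `N` makes this cost sublinear. -/

namespace SemiringPreorder

/-! ### Preorder calculus and multiplicative catalysts. -/

section Basic

variable {S : Type*} [CommSemiring S] (P : SemiringPreorder S)

instance : Trans P.le P.le P.le := ⟨fun h₁ h₂ => P.trans _ _ _ h₁ h₂⟩

variable {P}

theorem le_rfl {a : S} : P.le a a := P.refl a

theorem le_of_eq {a b : S} (h : a = b) : P.le a b := h ▸ P.refl a

theorem le_trans' {a b c : S} (h₁ : P.le a b) (h₂ : P.le b c) : P.le a c := P.trans _ _ _ h₁ h₂

theorem zero_le (a : S) : P.le 0 a := by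
  simpa using P.mul_right 0 1 a P.zero_le_one

theorem add_le_add {a b c d : S} (h₁ : P.le a b) (h₂ : P.le c d) : P.le (a + c) (b + d) :=
  le_trans' (P.add_right _ _ c h₁) (by simpa only [add_comm b] using P.add_right _ _ b h₂)

theorem mul_le_mul {a b c d : S} (h₁ : P.le a b) (h₂ : P.le c d) : P.le (a * c) (b * d) :=
  le_trans' (P.mul_right _ _ c h₁) (by simpa only [mul_comm b] using P.mul_right _ _ b h₂)

theorem mul_le_mul_left {a b : S} (c : S) (h : P.le a b) : P.le (c * a) (c * b) :=
  mul_le_mul le_rfl h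

theorem pow_le_pow {a b : S} (h : P.le a b) (n : ℕ) : P.le (a ^ n) (b ^ n) := by
  induction n with
  | zero => simpa using le_rfl
  | succ n ih => simpa only [pow_succ] using mul_le_mul ih h

theorem one_le_pow {a : S} (h : P.le 1 a) (n : ℕ) : P.le 1 (a ^ n) := by
  simpa using pow_le_pow h n

theorem pow_le_pow_right {a : S} (h : P.le 1 a) {m n : ℕ} (hmn : m ≤ n) :
    P.le (a ^ m) (a ^ n) := by
  obtain ⟨k, rfl⟩ := Nat.exists_eq_add_of_le hmn
  simpa [pow_add] using mul_le_mul_left (a ^ m) (one_le_pow h k)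

theorem le_add_right (a b : S) : P.le a (a + b) := by
  simpa using add_le_add (le_rfl (P := P) (a := a)) (zero_le b)

theorem le_add_left (a b : S) : P.le a (b + a) := by
  simpa only [add_comm] using le_add_right (P := P) a b

theorem cast_le_cast {m n : ℕ} (h : m ≤ n) : P.le (m : S) (n : S) := by
  obtain ⟨k, rfl⟩ := Nat.exists_eq_add_of_le h
  simpa using le_add_right (P := P) (m : S) k

variable (P)

/-- The natural numbers are not collapsed by the preorder. -/
def IsProper : Prop := ∀ n : ℕ, ¬ P.le ((n : S) + 1) n

/-- Every nonzero element lies between two positive rational numbers. -/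
def IsBounded : Prop := ∀ s : S, s ≠ 0 → ∃ n : ℕ, P.le 1 ((n : S) * s) ∧ P.le s n

variable {P}

theorem NatOrderEmbedding.isProper (h : P.NatOrderEmbedding) : P.IsProper := fun n hn => by
  have := (h (n + 1) n).1 (by simpa using hn)
  omega

theorem IsProper.le_of_cast_le (h : P.IsProper) {a b : ℕ} (hab : P.le (a : S) b) : a ≤ b := by
  by_contra! hlt
  refine h b (le_trans' ?_ hab)
  simpa using cast_le_cast (P := P) (S := S) (Nat.succ_le_of_lt hlt)

theorem IsProper.not_one_le_zero (h : P.IsProper) : ¬ P.le 1 0 := fun h' => h 0 (by simpa using h')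

theorem IsBounded.mul_ne_zero (hb : P.IsBounded) (hp : P.IsProper) {a b : S} (ha : a ≠ 0)
    (hb' : b ≠ 0) : a * b ≠ 0 := fun h => by
  obtain ⟨m, hm, -⟩ := hb a ha
  obtain ⟨n, hn, -⟩ := hb b hb'
  refine hp.not_one_le_zero ?_
  have := mul_le_mul hm hn
  rwa [mul_mul_mul_comm, h, mul_one, mul_zero] at this

/-- The factors `a` are exchanged one at a time; each exchange uses `z` and returns it. -/
theorem mul_pow_le_mul_pow {z a b : S} (h : P.le (z * a) (z * b)) (i : ℕ) :
    P.le (z * a ^ i) (z * b ^ i) := by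
  induction i with
  | zero => simpa using le_rfl
  | succ i ih =>
    calc P.le (z * a ^ (i + 1)) (a * (z * a ^ i)) := le_of_eq (by ring)
      P.le _ (a * (z * b ^ i)) := mul_le_mul_left _ ih
      P.le _ (b ^ i * (z * a)) := le_of_eq (by ring)
      P.le _ (b ^ i * (z * b)) := mul_le_mul_left _ h
      P.le _ (z * b ^ (i + 1)) := le_of_eq (by ring)

/-- The rational bounds on the catalyst are paid once, so `K` does not depend on `i`. -/
theorem IsBounded.pow_le_of_mul_le (hb : P.IsBounded) {z a b : S} (hz : z ≠ 0)
    (h : P.le (z * a) (z * b)) : ∃ K : ℕ, ∀ i : ℕ, P.le (a ^ i) ((K : S) * b ^ i) := by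
  obtain ⟨n, h₁, h₂⟩ := hb z hz
  refine ⟨n * n, fun i => ?_⟩
  calc P.le (a ^ i) (1 * a ^ i) := le_of_eq (by ring)
    P.le _ (n * z * a ^ i) := mul_le_mul h₁ le_rfl
    P.le _ (n * (z * a ^ i)) := le_of_eq (by ring)
    P.le _ (n * (z * b ^ i)) := mul_le_mul_left _ (mul_pow_le_mul_pow h i)
    P.le _ (n * (n * b ^ i)) := mul_le_mul_left _ (mul_le_mul h₂ le_rfl)
    P.le _ (((n * n : ℕ) : S) * b ^ i) := le_of_eq (by push_cast; ring)

end Basic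

theorem le_of_forall_pow_le_mul_pow {a b K : ℝ} (hb : 0 ≤ b)
    (h : ∀ i : ℕ, a ^ i ≤ K * b ^ i) : a ≤ b := by
  by_contra! hlt
  have ha : 0 < a := hb.trans_lt hlt
  have ht : Filter.Tendsto (fun i : ℕ => K * (b / a) ^ i) Filter.atTop (nhds (K * 0)) :=
    (tendsto_pow_atTop_nhds_zero_of_lt_one (by positivity) ((div_lt_one ha).2 hlt)).const_mul K
  rw [mul_zero] at ht
  obtain ⟨i, hi⟩ := (ht.eventually (gt_mem_nhds (zero_lt_one' ℝ))).exists
  have := h i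
  rw [div_pow, mul_div_assoc', div_lt_one (by positivity)] at hi
  linarith

/-! ### Enlarging the preorder while keeping it proper. -/

section Adjoin

variable {S : Type*} [CommSemiring S] (P : SemiringPreorder S)

/-- The preorder generated by `P` and the relation `x ≼ y`. -/
def adjoin (x y : S) : SemiringPreorder S where
  le a b := ∃ s, P.le (a + s * y) (b + s * x)
  refl a := ⟨0, by simpa using le_rfl⟩
  trans a b c := by
    rintro ⟨s, hs⟩ ⟨t, ht⟩
    refine ⟨s + t, ?_⟩
    calc P.le (a + (s + t) * y) (a + s * y + t * y) := le_of_eq (by ring)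
      P.le _ (b + s * x + t * y) := P.add_right _ _ _ hs
      P.le _ (b + t * y + s * x) := le_of_eq (by ring)
      P.le _ (c + t * x + s * x) := P.add_right _ _ _ ht
      P.le _ (c + (s + t) * x) := le_of_eq (by ring)
  zero_le_one := ⟨0, by simpa using P.zero_le_one⟩
  add_right a b c := by
    rintro ⟨s, hs⟩
    exact ⟨s, by simpa only [add_right_comm] using P.add_right _ _ c hs⟩
  mul_right a b c := by
    rintro ⟨s, hs⟩
    refine ⟨s * c, ?_⟩
    have := P.mul_right _ _ c hs
    rwa [add_mul, add_mul, mul_right_comm s y, mul_right_comm s x] at this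

theorem le_adjoin {x y a b : S} (h : P.le a b) : (P.adjoin x y).le a b :=
  ⟨0, by simpa using h⟩

theorem adjoin_le (x y : S) : (P.adjoin x y).le x y :=
  ⟨1, by simpa [add_comm] using le_rfl⟩

/-- `y ≼ x` holds after cancelling factors, up to a factor arbitrarily close to `1`. -/
def ApproxLE (y x : S) : Prop :=
  ∀ e : ℕ, ∃ z : S, z ≠ 0 ∧ P.le ((e : S) * (z * y)) (((e : S) + 1) * (z * x))

variable {P}

/-- The additive counterpart of a catalyst: `c` survives each replacement of `a` by `b`. -/
theorem add_mul_le_add_mul {a b c : S} (h : P.le (c + a) (c + b)) (N : ℕ) :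
    P.le (c + N * a) (c + N * b) := by
  induction N with
  | zero => simpa using le_rfl
  | succ N ih =>
    calc P.le (c + (N + 1 : ℕ) * a) (c + N * a + a) := le_of_eq (by push_cast; ring)
      P.le _ (c + N * b + a) := P.add_right _ _ _ ih
      P.le _ (c + a + N * b) := le_of_eq (by ring)
      P.le _ (c + b + N * b) := P.add_right _ _ _ h
      P.le _ (c + (N + 1 : ℕ) * b) := le_of_eq (by push_cast; ring)

/-- A collapse `n + 1 + s * y ≼ n + s * x` can be iterated with `n` as additive catalyst. After many
rounds `n` is negligible against the multiples of `s * x`, which leaves `y ≼ x` approximately. -/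
theorem IsBounded.isProper_adjoin (hb : P.IsBounded) (hp : P.IsProper) {x y : S}
    (h : ¬ P.ApproxLE y x) : (P.adjoin x y).IsProper := by
  rintro n ⟨s, hs⟩
  apply h
  have hs' : P.le ((n : S) + (1 + s * y)) (n + s * x) := by simpa only [add_assoc] using hs
  have hsx : s * x ≠ 0 := fun h0 => by
    rw [h0, add_zero] at hs
    exact hp n (le_trans' (le_add_right _ _) hs)
  obtain ⟨k, hk, -⟩ := hb _ hsx
  have hle : P.le ((n * k + k : ℕ) * (s * x)) (((n * k + k : ℕ) : S) * s * x) :=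
    le_of_eq (by ring)
  intro e
  -- Since `1 ≼ k * (s * x)`, the part `n * k` of the coefficient absorbs `n`; the extra `k` keeps
  -- the catalyst nonzero when `n = 0`.
  refine ⟨((n * k + k : ℕ) : S) * s, fun h0 => hp.not_one_le_zero ?_, ?_⟩
  · calc P.le 1 (k * (s * x)) := hk
      P.le _ ((n * k + k : ℕ) * (s * x)) := mul_le_mul (cast_le_cast (by omega)) le_rfl
      P.le _ (((n * k + k : ℕ) : S) * s * x) := hle
      P.le _ 0 := le_of_eq (by rw [h0, zero_mul])
  · have hn : P.le (n : S) ((n * k + k : ℕ) * s * x) := by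
      calc P.le (n : S) (n * 1) := le_of_eq (by ring)
        P.le _ (n * (k * (s * x))) := mul_le_mul_left _ hk
        P.le _ (n * (k * (s * x)) + k * (s * x)) := le_add_right _ _
        P.le _ ((n * k + k : ℕ) * s * x) := le_of_eq (by push_cast; ring)
    have := add_mul_le_add_mul hs' (e * (n * k + k))
    calc P.le ((e : S) * ((n * k + k : ℕ) * s * y))
          ((e * (n * k + k) : ℕ) * (s * y) + (n + (e * (n * k + k) : ℕ))) :=
            le_trans' (le_of_eq (by push_cast; ring)) (le_add_right _ _)
      P.le _ ((n : S) + (e * (n * k + k) : ℕ) * (1 + s * y)) := le_of_eq (by ring)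
      P.le _ ((n : S) + (e * (n * k + k) : ℕ) * (s * x)) := this
      P.le _ ((n * k + k : ℕ) * s * x + (e * (n * k + k) : ℕ) * (s * x)) :=
        P.add_right _ _ _ hn
      P.le _ (((e : S) + 1) * ((n * k + k : ℕ) * s * x)) := le_of_eq (by push_cast; ring)

/-- Zorn's lemma: a collapse in the union of a chain already occurs in one of its members. -/
theorem IsProper.exists_maximal (hp : P.IsProper) : ∃ Q : SemiringPreorder S,
    (∀ a b, P.le a b → Q.le a b) ∧ Q.IsProper ∧
    ∀ Q' : SemiringPreorder S, (∀ a b, Q.le a b → Q'.le a b) → Q'.IsProper →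
      ∀ a b, Q'.le a b → Q.le a b := by
  let α := {Q : SemiringPreorder S // (∀ a b, P.le a b → Q.le a b) ∧ Q.IsProper}
  let r : α → α → Prop := fun Q Q' => ∀ a b, Q.1.le a b → Q'.1.le a b
  have hz : ∃ m : α, ∀ a, r m a → r a m := by
    refine exists_maximal_of_chains_bounded (fun c hc => ?_) fun h₁ h₂ a b h => h₂ a b (h₁ a b h)
    rcases c.eq_empty_or_nonempty with rfl | ⟨Q₀, hQ₀⟩
    · exact ⟨⟨P, fun _ _ h => h, hp⟩, by simp⟩
    have hdir : ∀ Q ∈ c, ∀ Q' ∈ c, ∃ R ∈ c, r Q R ∧ r Q' R := fun Q hQ Q' hQ' => by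
      by_cases h : Q = Q'
      · exact ⟨Q', hQ', h ▸ fun _ _ h => h, fun _ _ h => h⟩
      rcases hc hQ hQ' h with h | h
      · exact ⟨Q', hQ', h, fun _ _ h => h⟩
      · exact ⟨Q, hQ, fun _ _ h => h, h⟩
    let R₀ : SemiringPreorder S :=
      { le := fun a b => ∃ Q ∈ c, Q.1.le a b
        refl := fun a => ⟨Q₀, hQ₀, Q₀.1.refl a⟩
        trans := by
          rintro a b d ⟨Q, hQ, h⟩ ⟨Q', hQ', h'⟩
          obtain ⟨R, hR, h₁, h₂⟩ := hdir Q hQ Q' hQ'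
          exact ⟨R, hR, le_trans' (h₁ _ _ h) (h₂ _ _ h')⟩
        zero_le_one := ⟨Q₀, hQ₀, Q₀.1.zero_le_one⟩
        add_right := by
          rintro a b d ⟨Q, hQ, h⟩
          exact ⟨Q, hQ, Q.1.add_right _ _ _ h⟩
        mul_right := by
          rintro a b d ⟨Q, hQ, h⟩
          exact ⟨Q, hQ, Q.1.mul_right _ _ _ h⟩ }
    refine ⟨⟨R₀, fun a b h => ⟨Q₀, hQ₀, Q₀.2.1 a b h⟩, ?_⟩, fun Q hQ a b h => ⟨Q, hQ, h⟩⟩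
    rintro n ⟨Q, hQ, h⟩
    exact Q.2.2 n h
  obtain ⟨m, hm⟩ := hz
  exact ⟨m.1, m.2.1, m.2.2, fun Q' h hQ' => hm ⟨Q', fun a b hab => h _ _ (m.2.1 _ _ hab), hQ'⟩ h⟩

end Adjoin

/-! ### Strassen's theorem for bounded preordered semirings. -/

section Strassen

variable {S : Type*} [CommSemiring S] {P Q : SemiringPreorder S}

/-- The rational cut of `s` has no gap. If both inequalities failed, then approximately `q * s ≼ p`
and `p' ≼ q' * s`, which combine to `p' * q ≼ p * q'`; taking powers removes the catalyst and
contradicts `hlt`. -/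
theorem IsProper.le_of_approxLE (hp : Q.IsProper) (hb : Q.IsBounded)
    (hdich : ∀ x y : S, Q.le x y ∨ Q.ApproxLE y x) {s : S} {p q p' q' : ℕ}
    (hlt : p * q' < p' * q) (h : ¬ Q.le ((q' : S) * s) p') : Q.le (p : S) (q * s) := by
  by_contra hpq
  have h₁ := (hdich _ _).resolve_left hpq
  have h₂ := (hdich _ _).resolve_left h
  -- With `B = p * q'`, the choice `e = 2 * B + 2` makes `e² * (B + 1) > (e + 1)² * B`.
  obtain ⟨z, hz, hz'⟩ := h₁ (2 * (p * q') + 2)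
  obtain ⟨w, hw, hw'⟩ := h₂ (2 * (p * q') + 2)
  set e : ℕ := 2 * (p * q') + 2 with he
  have key : Q.le (z * w * ((e * e * (p' * q) : ℕ) : S))
      (z * w * (((e + 1) * (e + 1) * (p * q') : ℕ) : S)) := by
    calc Q.le (z * w * ((e * e * (p' * q) : ℕ) : S)) (e * z * q * (e * (w * p'))) :=
          le_of_eq (by push_cast; ring)
      Q.le _ (e * z * q * ((e + 1) * (w * (q' * s)))) := mul_le_mul_left _ hw'
      Q.le _ ((e + 1) * w * q' * (e * (z * (q * s)))) := le_of_eq (by ring)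
      Q.le _ ((e + 1) * w * q' * ((e + 1) * (z * p))) := mul_le_mul_left _ hz'
      Q.le _ (z * w * (((e + 1) * (e + 1) * (p * q') : ℕ) : S)) :=
          le_of_eq (by push_cast; ring)
  obtain ⟨K, hK⟩ := hb.pow_le_of_mul_le (hb.mul_ne_zero hp hz hw) key
  have hle : ((e * e * (p' * q) : ℕ) : ℝ) ≤ ((e + 1) * (e + 1) * (p * q') : ℕ) := by
    refine le_of_forall_pow_le_mul_pow (K := K) (by positivity) fun i => ?_
    exact_mod_cast hp.le_of_cast_le (by simpa using hK i)
  have hle' : e * e * (p' * q) ≤ (e + 1) * (e + 1) * (p * q') := by exact_mod_cast hle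
  generalize p * q' = B at *
  have : e * e * (B + 1) ≤ (e + 1) * (e + 1) * B := (Nat.mul_le_mul_left _ hlt).trans hle'
  rw [he] at this
  nlinarith

theorem exists_nat_div_btwn {a b : ℝ≥0} (h : a < b) :
    ∃ p q : ℕ, 0 < q ∧ a < (p : ℝ≥0) / q ∧ (p : ℝ≥0) / q < b := by
  obtain ⟨r, hr, h₁, h₂⟩ := (NNReal.lt_iff_exists_rat_btwn a b).1 h
  have hr' : ((r : ℝ)) = ((r.num.toNat : ℝ≥0) / r.den : ℝ≥0) := by
    have : (r.num.toNat : ℤ) = r.num := Int.toNat_of_nonneg (Rat.num_nonneg.2 hr)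
    have h' : ((r.num.toNat : ℕ) : ℝ) = (r.num : ℝ) := by exact_mod_cast this
    rw [NNReal.coe_div, NNReal.coe_natCast, NNReal.coe_natCast, h']
    exact_mod_cast (Rat.num_div_den r).symm
  rw [hr', Real.toNNReal_coe] at h₁ h₂
  exact ⟨_, _, r.den_pos, h₁, h₂⟩

variable (Q) in
/-- The infimum of the rational numbers that dominate `s`. -/
noncomputable def upperValue (s : S) : ℝ≥0 :=
  sInf {r | ∃ p q : ℕ, 0 < q ∧ Q.le ((q : S) * s) p ∧ r = (p : ℝ≥0) / q}

theorem upperValue_le {s : S} {p q : ℕ} (hq : 0 < q) (h : Q.le ((q : S) * s) p) :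
    Q.upperValue s ≤ (p : ℝ≥0) / q :=
  csInf_le (OrderBot.bddBelow _) ⟨p, q, hq, h, rfl⟩

theorem IsBounded.exists_le (hb : Q.IsBounded) (s : S) : ∃ n : ℕ, Q.le s n := by
  by_cases hs : s = 0
  · exact ⟨0, by simpa [hs] using le_rfl⟩
  · obtain ⟨n, -, hn⟩ := hb s hs
    exact ⟨n, hn⟩

theorem IsBounded.exists_of_upperValue_lt (hb : Q.IsBounded) {s : S} {c : ℝ≥0}
    (h : Q.upperValue s < c) :
    ∃ p q : ℕ, 0 < q ∧ Q.le ((q : S) * s) p ∧ (p : ℝ≥0) / q < c := by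
  obtain ⟨n, hn⟩ := hb.exists_le s
  obtain ⟨r, ⟨p, q, hq, hle, rfl⟩, hr⟩ := exists_lt_of_csInf_lt
    (s := {r | ∃ p q : ℕ, 0 < q ∧ Q.le ((q : S) * s) p ∧ r = (p : ℝ≥0) / q})
    ⟨(n : ℝ≥0) / (1 : ℕ), n, 1, one_pos, by simpa using hn, rfl⟩ h
  exact ⟨p, q, hq, hle, hr⟩

theorem IsProper.le_upperValue (hp : Q.IsProper) (hb : Q.IsBounded) {s : S} {p q : ℕ}
    (hq : 0 < q) (h : Q.le (p : S) (q * s)) : (p : ℝ≥0) / q ≤ Q.upperValue s := by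
  refine le_of_forall_gt fun c hc => ?_
  obtain ⟨p', q', hq', hle, hlt⟩ := hb.exists_of_upperValue_lt hc
  refine lt_of_le_of_lt ?_ hlt
  rw [div_le_div_iff₀ (by positivity) (by positivity)]
  have : p * q' ≤ p' * q := hp.le_of_cast_le (P := Q) (by
    calc Q.le ((p * q' : ℕ) : S) (q' * p) := le_of_eq (by push_cast; ring)
      Q.le _ (q' * (q * s)) := mul_le_mul_left _ h
      Q.le _ (q * (q' * s)) := le_of_eq (by ring)
      Q.le _ (q * p') := mul_le_mul_left _ hle
      Q.le _ ((p' * q : ℕ) : S) := le_of_eq (by push_cast; ring))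
  exact_mod_cast this

/-- Insert two fractions between `c` and the value: the larger is not an upper bound, so by the
absence of gaps the smaller is a lower bound. -/
theorem IsProper.exists_of_lt_upperValue (hp : Q.IsProper) (hb : Q.IsBounded)
    (hdich : ∀ x y : S, Q.le x y ∨ Q.ApproxLE y x) {s : S} {c : ℝ≥0}
    (h : c < Q.upperValue s) :
    ∃ p q : ℕ, 0 < q ∧ Q.le (p : S) (q * s) ∧ c < (p : ℝ≥0) / q := by
  obtain ⟨p', q', hq', h₁, h₂⟩ := exists_nat_div_btwn h
  obtain ⟨p, q, hq, h₃, h₄⟩ := exists_nat_div_btwn h₁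
  refine ⟨p, q, hq, hp.le_of_approxLE hb hdich (p' := p') (q' := q') ?_ fun hle => ?_, h₃⟩
  · rw [div_lt_div_iff₀ (by positivity) (by positivity)] at h₄
    exact_mod_cast h₄
  · exact absurd (upperValue_le hq' hle) (not_le.2 h₂)

/-- The value is approximated by rationals from both sides. Adding and multiplying upper bounds
gives one inequality for sums and products, lower bounds the other. -/
theorem exists_spectrum_of_dichotomy (hp : Q.IsProper) (hb : Q.IsBounded)
    (hdich : ∀ x y : S, Q.le x y ∨ Q.ApproxLE y x) : Nonempty Q.Spectrum := by
  have hmono : ∀ a b, Q.le a b → Q.upperValue a ≤ Q.upperValue b := fun a b hab => by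
    refine le_of_forall_gt fun c hc => ?_
    obtain ⟨p, q, hq, hle, hlt⟩ := hb.exists_of_upperValue_lt hc
    exact (upperValue_le hq (le_trans' (mul_le_mul_left _ hab) hle)).trans_lt hlt
  have hcast : ∀ n : ℕ, Q.upperValue (n : S) = n := fun n => by
    refine le_antisymm ?_ ?_
    · simpa using upperValue_le (Q := Q) (s := (n : S)) (p := n) one_pos (by simpa using le_rfl)
    · simpa using hp.le_upperValue hb (s := (n : S)) (p := n) one_pos (by simpa using le_rfl)
  have hlow : ∀ s, ∀ ε : ℝ≥0, 0 < ε → ∃ p q : ℕ, 0 < q ∧ Q.le (p : S) (q * s) ∧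
      Q.upperValue s < (p : ℝ≥0) / q + ε := fun s ε hε => by
    rcases eq_zero_or_pos (Q.upperValue s) with h0 | h0
    · exact ⟨0, 1, one_pos, by simpa using zero_le _, by simpa [h0] using hε⟩
    · obtain ⟨p, q, hq, hle, hlt⟩ :=
        hp.exists_of_lt_upperValue hb hdich (tsub_lt_self h0 hε)
      exact ⟨p, q, hq, hle, lt_add_of_tsub_lt_right hlt⟩
  have hadd : ∀ a b, Q.upperValue (a + b) = Q.upperValue a + Q.upperValue b := fun a b => by
    refine le_antisymm (le_of_forall_pos_le_add fun ε hε => ?_)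
      (le_of_forall_pos_le_add fun ε hε => ?_)
    · obtain ⟨p, q, hq, hle, hlt⟩ :=
        hb.exists_of_upperValue_lt (lt_add_of_pos_right (Q.upperValue a) (half_pos hε))
      obtain ⟨p', q', hq', hle', hlt'⟩ :=
        hb.exists_of_upperValue_lt (lt_add_of_pos_right (Q.upperValue b) (half_pos hε))
      have : Q.le (((q * q' : ℕ) : S) * (a + b)) ((p * q' + q * p' : ℕ) : S) := by
        calc Q.le (((q * q' : ℕ) : S) * (a + b)) (q' * (q * a) + q * (q' * b)) :=
              le_of_eq (by push_cast; ring)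
          Q.le _ (q' * p + q * p') := add_le_add (mul_le_mul_left _ hle) (mul_le_mul_left _ hle')
          Q.le _ _ := le_of_eq (by push_cast; ring)
      calc Q.upperValue (a + b) ≤ ((p * q' + q * p' : ℕ) : ℝ≥0) / (q * q' : ℕ) :=
            upperValue_le (Nat.mul_pos hq hq') this
        _ = (p : ℝ≥0) / q + (p' : ℝ≥0) / q' := by
            rw [div_add_div _ _ (by positivity) (by positivity)]; push_cast; rfl
        _ ≤ (Q.upperValue a + ε / 2) + (Q.upperValue b + ε / 2) := _root_.add_le_add hlt.le hlt'.le
        _ = Q.upperValue a + Q.upperValue b + ε := by rw [add_add_add_comm, add_halves]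
    · obtain ⟨p, q, hq, hle, hlt⟩ := hlow a _ (half_pos hε)
      obtain ⟨p', q', hq', hle', hlt'⟩ := hlow b _ (half_pos hε)
      have : Q.le ((p * q' + q * p' : ℕ) : S) (((q * q' : ℕ) : S) * (a + b)) := by
        calc Q.le ((p * q' + q * p' : ℕ) : S) (q' * p + q * p') := le_of_eq (by push_cast; ring)
          Q.le _ (q' * (q * a) + q * (q' * b)) :=
            add_le_add (mul_le_mul_left _ hle) (mul_le_mul_left _ hle')
          Q.le _ _ := le_of_eq (by push_cast; ring)
      calc Q.upperValue a + Q.upperValue b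
          ≤ ((p : ℝ≥0) / q + ε / 2) + ((p' : ℝ≥0) / q' + ε / 2) := _root_.add_le_add hlt.le hlt'.le
        _ = ((p * q' + q * p' : ℕ) : ℝ≥0) / (q * q' : ℕ) + ε := by
            rw [add_add_add_comm, add_halves, div_add_div _ _ (by positivity) (by positivity)]
            push_cast; rfl
        _ ≤ Q.upperValue (a + b) + ε :=
            add_le_add_left (hp.le_upperValue hb (Nat.mul_pos hq hq') this) _
  have hmul : ∀ a b, Q.upperValue (a * b) = Q.upperValue a * Q.upperValue b := fun a b => by
    refine le_antisymm ?_ ?_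
    · rw [← NNReal.coe_le_coe, NNReal.coe_mul]
      refine le_mul_of_forall_lt₀ fun a' ha' b' hb' => ?_
      lift a' to ℝ≥0 using (NNReal.coe_nonneg _).trans ha'.le
      lift b' to ℝ≥0 using (NNReal.coe_nonneg _).trans hb'.le
      rw [gt_iff_lt, NNReal.coe_lt_coe] at ha' hb'
      rw [← NNReal.coe_mul, NNReal.coe_le_coe]
      obtain ⟨p, q, hq, hle, hlt⟩ := hb.exists_of_upperValue_lt ha'
      obtain ⟨p', q', hq', hle', hlt'⟩ := hb.exists_of_upperValue_lt hb'
      have : Q.le (((q * q' : ℕ) : S) * (a * b)) ((p * p' : ℕ) : S) := by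
        calc Q.le (((q * q' : ℕ) : S) * (a * b)) ((q * a) * (q' * b)) :=
              le_of_eq (by push_cast; ring)
          Q.le _ (p * p') := mul_le_mul hle hle'
          Q.le _ _ := le_of_eq (by push_cast; ring)
      calc Q.upperValue (a * b) ≤ ((p * p' : ℕ) : ℝ≥0) / (q * q' : ℕ) :=
            upperValue_le (Nat.mul_pos hq hq') this
        _ = (p : ℝ≥0) / q * ((p' : ℝ≥0) / q') := by rw [div_mul_div_comm]; push_cast; rfl
        _ ≤ a' * b' := _root_.mul_le_mul' hlt.le hlt'.le
    · rw [← NNReal.coe_le_coe, NNReal.coe_mul]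
      refine mul_le_of_forall_lt_of_nonneg (NNReal.coe_nonneg _) (NNReal.coe_nonneg _)
        fun a' h0 ha' b' h0' hb' => ?_
      lift a' to ℝ≥0 using h0
      lift b' to ℝ≥0 using h0'
      obtain ⟨p, q, hq, hle, hlt⟩ :=
        hp.exists_of_lt_upperValue hb hdich (NNReal.coe_lt_coe.1 ha')
      obtain ⟨p', q', hq', hle', hlt'⟩ :=
        hp.exists_of_lt_upperValue hb hdich (NNReal.coe_lt_coe.1 hb')
      have : Q.le ((p * p' : ℕ) : S) (((q * q' : ℕ) : S) * (a * b)) := by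
        calc Q.le ((p * p' : ℕ) : S) (p * p') := le_of_eq (by push_cast; ring)
          Q.le _ ((q * a) * (q' * b)) := mul_le_mul hle hle'
          Q.le _ _ := le_of_eq (by push_cast; ring)
      have h : a' * b' ≤ Q.upperValue (a * b) := by
        calc a' * b' ≤ (p : ℝ≥0) / q * ((p' : ℝ≥0) / q') := _root_.mul_le_mul' hlt.le hlt'.le
          _ = ((p * p' : ℕ) : ℝ≥0) / (q * q' : ℕ) := by rw [div_mul_div_comm]; push_cast; rfl
          _ ≤ Q.upperValue (a * b) := hp.le_upperValue hb (Nat.mul_pos hq hq') this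
      exact_mod_cast h
  exact ⟨⟨{ toFun := Q.upperValue, map_one' := by simpa using hcast 1,
            map_zero' := by simpa using hcast 0, map_add' := hadd, map_mul' := hmul }, hmono⟩⟩

/-- Maximality yields the dichotomy: unless `y ≼ x` holds approximately, `x ≼ y` can be adjoined
properly, hence already holds. -/
theorem IsProper.nonempty_spectrum (hp : P.IsProper) (hb : P.IsBounded) : Nonempty P.Spectrum := by
  obtain ⟨Q, hPQ, hQ, hmax⟩ := hp.exists_maximal
  have hbQ : Q.IsBounded := fun s hs =>
    (hb s hs).imp fun n hn => ⟨hPQ _ _ hn.1, hPQ _ _ hn.2⟩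
  obtain ⟨f⟩ := exists_spectrum_of_dichotomy hQ hbQ fun x y => by
    by_cases h : Q.ApproxLE y x
    · exact .inr h
    · exact .inl (hmax _ (fun _ _ => Q.le_adjoin) (hbQ.isProper_adjoin hQ h) _ _
        (Q.adjoin_le x y))
  exact ⟨f.1, fun a b h => f.2 a b (hPQ _ _ h)⟩

theorem IsProper.exists_spectrum_le (hp : P.IsProper) (hb : P.IsBounded) {x y : S}
    (h : ¬ P.ApproxLE y x) : ∃ f : P.Spectrum, P.ev x f ≤ P.ev y f := by
  have hb' : (P.adjoin x y).IsBounded := fun s hs =>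
    (hb s hs).imp fun n hn => ⟨P.le_adjoin hn.1, P.le_adjoin hn.2⟩
  obtain ⟨f⟩ := (hb.isProper_adjoin hp h).nonempty_spectrum hb'
  exact ⟨⟨f.1, fun a b h => f.2 a b (P.le_adjoin h)⟩, f.2 x y (P.adjoin_le x y)⟩

theorem ev_pos_of_one_le {f : P.Spectrum} {n : ℕ} {s : S} (h : P.le 1 ((n : S) * s)) :
    0 < P.ev s f := by
  have := f.2 _ _ h
  rw [map_one, map_mul, map_natCast] at this
  refine pos_iff_ne_zero.2 fun h0 => ?_
  change f.1 s = 0 at h0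
  rw [h0, mul_zero] at this
  exact absurd this (by simp)

/-- Strassen's theorem: a pointwise inequality on the spectrum of a bounded preordered semiring
holds in the semiring up to cancellation and a factor close to `1`. -/
theorem IsProper.exists_mul_le_of_ev_le (hp : P.IsProper) (hb : P.IsBounded) {x y : S} (hx : x ≠ 0)
    (h : ∀ f : P.Spectrum, P.ev y f ≤ P.ev x f) (e : ℕ) :
    ∃ z : S, z ≠ 0 ∧ P.le (z * ((e : S) * e * y)) (z * (((e : S) + 1) * (e + 1) * x)) := by
  -- The perturbed pair forces strictness: a failure would give `f` with `(e + 1) * f x ≤ e * f y ≤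
  -- e * f x`, although `f x > 0`.
  by_cases happ : P.ApproxLE ((e : S) * y) ((e + 1) * x)
  · obtain ⟨z, hz, hle⟩ := happ e
    refine ⟨z, hz, ?_⟩
    convert hle using 1 <;> ring
  · obtain ⟨f, hf⟩ := hp.exists_spectrum_le hb happ
    obtain ⟨n, hn, -⟩ := hb x hx
    have hpos := ev_pos_of_one_le (f := f) hn
    have hyx := h f
    simp only [ev, map_mul, map_add, map_natCast, map_one] at hf hpos hyx
    exact absurd (hf.trans (mul_le_mul_right hyx _)) (not_le.2
      (mul_lt_mul_of_pos_right (lt_add_one _) hpos))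

end Strassen
-- Topology of the spectrum.
section Topology

variable {S : Type*} [CommSemiring S] (P : SemiringPreorder S)

theorem continuous_ev (s : S) : Continuous (P.ev s) :=
  continuous_iInf_dom continuous_induced_dom

/-- Being a monotone homomorphism is a family of closed conditions in the product `S → ℝ≥0`. -/
theorem isClosedEmbedding_ev :
    Topology.IsClosedEmbedding (fun (f : P.Spectrum) (s : S) => P.ev s f) := by
  refine ⟨⟨inducing_iInf_to_pi _, fun f g h => Subtype.ext (RingHom.ext (congrFun h))⟩, ?_⟩
  have : Set.range (fun (f : P.Spectrum) (s : S) => P.ev s f) =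
      {g | g 0 = 0} ∩ {g | g 1 = 1} ∩ (⋂ a, ⋂ b, {g | g (a + b) = g a + g b}) ∩
      (⋂ a, ⋂ b, {g | g (a * b) = g a * g b}) ∩
      ⋂ a, ⋂ b, ⋂ _ : P.le a b, {g : S → ℝ≥0 | g a ≤ g b} := by
    ext g
    simp only [Set.mem_range, Set.mem_inter_iff, Set.mem_ofPred_eq, Set.mem_iInter]
    constructor
    · rintro ⟨f, rfl⟩
      exact ⟨⟨⟨⟨map_zero f.1, map_one f.1⟩, map_add f.1⟩, map_mul f.1⟩, f.2⟩
    · rintro ⟨⟨⟨⟨h0, h1⟩, hadd⟩, hmul⟩, hmono⟩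
      exact ⟨⟨{ toFun := g, map_one' := h1, map_zero' := h0, map_add' := hadd,
                map_mul' := hmul }, hmono⟩, rfl⟩
  rw [this]
  refine ((((isClosed_eq (by fun_prop) (by fun_prop)).inter
    (isClosed_eq (by fun_prop) (by fun_prop))).inter
    (isClosed_iInter fun a => isClosed_iInter fun b =>
      isClosed_eq (by fun_prop) (by fun_prop))).inter
    (isClosed_iInter fun a => isClosed_iInter fun b =>
      isClosed_eq (by fun_prop) (by fun_prop))).inter
    (isClosed_iInter fun a => isClosed_iInter fun b => isClosed_iInter fun _ =>
      isClosed_le (by fun_prop) (by fun_prop))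

instance Spectrum.instT2Space : T2Space P.Spectrum :=
  P.isClosedEmbedding_ev.isEmbedding.t2Space

variable {P}

/-- A bound `f u ≤ C` gives `f s ≤ C ^ k s` for every `s`, so Tychonoff's theorem applies. -/
theorem IsPowerUniversal.isProperMap_ev {u : S} (hu : P.IsPowerUniversal u) :
    IsProperMap (P.ev u) := by
  refine isProperMap_iff_isCompact_preimage.2 ⟨P.continuous_ev u, fun K hK => ?_⟩
  obtain ⟨C, hC⟩ := hK.bddAbove
  have hle : ∀ s : S, ∃ k : ℕ, P.le s (u ^ k) := fun s => by
    by_cases hs : s = 0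
    · exact ⟨0, by simpa [hs] using P.zero_le_one⟩
    · exact (hu s hs).imp fun k hk => hk.2
  choose k hk using hle
  refine (P.isClosedEmbedding_ev.isCompact_preimage
    (isCompact_univ_pi fun s => isCompact_Icc (a := 0) (b := C ^ k s))).of_isClosed_subset
    (hK.isClosed.preimage (P.continuous_ev u)) fun f hf => ?_
  simp only [Set.mem_preimage, Set.mem_univ_pi, Set.mem_Icc]
  refine fun s => ⟨bot_le, ?_⟩
  calc P.ev s f ≤ f.1 (u ^ k s) := f.2 _ _ (hk s)
    _ = P.ev u f ^ k s := map_pow f.1 u _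
    _ ≤ C ^ k s := pow_le_pow_left₀ bot_le (hC hf) _

theorem IsPowerUniversal.locallyCompactSpace {u : S} (hu : P.IsPowerUniversal u) :
    LocallyCompactSpace P.Spectrum := by
  have : WeaklyLocallyCompactSpace P.Spectrum := ⟨fun f =>
    ⟨P.ev u ⁻¹' Set.Icc 0 (P.ev u f + 1),
      (isProperMap_iff_isCompact_preimage.1 hu.isProperMap_ev).2 isCompact_Icc,
      (P.continuous_ev u).continuousAt.preimage_mem_nhds
        (Filter.mem_of_superset (Iio_mem_nhds (lt_add_one _)) fun _ hx => ⟨bot_le, hx.le⟩)⟩⟩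
  infer_instance

end Topology

/-! ### From the bounded part to elements bounded above, and then to all of `S`. -/

section Extension

variable {S : Type*} [CommSemiring S] (P : SemiringPreorder S)

/-- The element `s` is dominated by a natural number. -/
def BddElem (s : S) : Prop := ∃ n : ℕ, P.le s n

/-- The subsemiring of elements that are zero or lie between two positive rational numbers. -/
def boundedPart : Subsemiring S where
  carrier := {s | s = 0 ∨ ∃ n : ℕ, P.le 1 ((n : S) * s) ∧ P.le s n}
  zero_mem' := .inl rfl
  one_mem' := .inr ⟨1, by simpa using le_rfl, by simpa using le_rfl⟩
  add_mem' := by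
    rintro s t (rfl | ⟨m, hm, hm'⟩) (rfl | ⟨n, hn, hn'⟩)
    · exact .inl (add_zero 0)
    · exact .inr ⟨n, by simpa using hn, by simpa using hn'⟩
    · exact .inr ⟨m, by simpa using hm, by simpa using hm'⟩
    · refine .inr ⟨m + n, ?_, by push_cast; exact add_le_add hm' hn'⟩
      refine le_trans' hm (le_trans' (le_add_right _ (m * t + n * (s + t))) (le_of_eq ?_))
      push_cast; ring
  mul_mem' := by
    rintro s t (rfl | ⟨m, hm, hm'⟩) (rfl | ⟨n, hn, hn'⟩)
    · exact .inl (mul_zero 0)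
    · exact .inl (zero_mul t)
    · exact .inl (mul_zero s)
    · refine .inr ⟨m * n, ?_, by push_cast; exact mul_le_mul hm' hn'⟩
      refine le_trans' (le_of_eq (one_mul 1).symm) (le_trans' (mul_le_mul hm hn) (le_of_eq ?_))
      push_cast; ring

variable {P}

theorem BddElem.mono {s t : S} (h : P.le s t) (ht : P.BddElem t) : P.BddElem s :=
  ht.imp fun _ hn => le_trans' h hn

theorem BddElem.natCast (n : ℕ) : P.BddElem (n : S) := ⟨n, le_rfl⟩

theorem BddElem.zero : P.BddElem (0 : S) := ⟨0, by simpa using le_rfl⟩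

theorem BddElem.one : P.BddElem (1 : S) := ⟨1, by simpa using le_rfl⟩

theorem BddElem.add {s t : S} (hs : P.BddElem s) (ht : P.BddElem t) : P.BddElem (s + t) := by
  obtain ⟨m, hm⟩ := hs
  obtain ⟨n, hn⟩ := ht
  exact ⟨m + n, by push_cast; exact add_le_add hm hn⟩

theorem BddElem.mul {s t : S} (hs : P.BddElem s) (ht : P.BddElem t) : P.BddElem (s * t) := by
  obtain ⟨m, hm⟩ := hs
  obtain ⟨n, hn⟩ := ht
  exact ⟨m * n, by push_cast; exact mul_le_mul hm hn⟩

theorem BddElem.pow {s : S} (hs : P.BddElem s) (n : ℕ) : P.BddElem (s ^ n) := by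
  induction n with
  | zero => simpa using BddElem.one
  | succ n ih => rw [pow_succ]; exact ih.mul hs

/-- Adding 1 supplies the positive lower bound that `s` may lack. -/
theorem BddElem.one_add_mem {s : S} (hs : P.BddElem s) : 1 + s ∈ P.boundedPart := by
  obtain ⟨n, hn⟩ := hs
  refine .inr ⟨n + 1, ?_, ?_⟩
  · refine le_trans' (le_add_right 1 (s + n * (1 + s))) (le_of_eq ?_)
    push_cast; ring
  · rw [add_comm]; push_cast; exact P.add_right _ _ _ hn

theorem bddElem_of_mem {s : S} (hs : s ∈ P.boundedPart) : P.BddElem s := by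
  rcases hs with rfl | ⟨n, -, hn⟩
  exacts [.zero, ⟨n, hn⟩]

theorem isBounded_boundedPart : (P.restrict P.boundedPart).IsBounded := by
  rintro ⟨s, hs⟩ h0
  rcases hs with rfl | ⟨n, hn, hn'⟩
  · exact absurd rfl h0
  · exact ⟨n, hn, hn'⟩

theorem IsProper.restrict (hp : P.IsProper) (S₀ : Subsemiring S) : (P.restrict S₀).IsProper :=
  fun n h => hp n h

variable (P) in
/-- A monotone semiring homomorphism defined on the elements dominated by a natural number, in
terms of a total function. -/
structure IsBddHom (g : S → ℝ≥0) : Prop where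
  map_zero : g 0 = 0
  map_one : g 1 = 1
  map_add : ∀ s t, P.BddElem s → P.BddElem t → g (s + t) = g s + g t
  map_mul : ∀ s t, P.BddElem s → P.BddElem t → g (s * t) = g s * g t
  mono : ∀ s t, P.le s t → P.BddElem t → g s ≤ g t

theorem IsBddHom.map_natCast {g : S → ℝ≥0} (hg : P.IsBddHom g) (n : ℕ) : g (n : S) = n := by
  induction n with
  | zero => simpa using hg.map_zero
  | succ n ih => push_cast; rw [hg.map_add _ _ (.natCast n) .one, ih, hg.map_one]

theorem IsBddHom.map_pow {g : S → ℝ≥0} (hg : P.IsBddHom g) {s : S} (hs : P.BddElem s) (n : ℕ) :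
    g (s ^ n) = g s ^ n := by
  induction n with
  | zero => simpa using hg.map_one
  | succ n ih => rw [pow_succ, pow_succ, hg.map_mul _ _ (hs.pow n) hs, ih]

/-- The extension is `s ↦ φ (1 + s) - 1`. For `s` bounded above the subtraction is genuine, because
`φ (1 + s) ≥ φ 1 = 1`; elsewhere the values are junk. -/
theorem exists_isBddHom (ψ : (P.restrict P.boundedPart).Spectrum) :
    ∃ g : S → ℝ≥0, P.IsBddHom g ∧ ∀ s : P.boundedPart, g s = ψ.1 s := by
  classical
  let φ : S → ℝ≥0 := fun s => if h : s ∈ P.boundedPart then ψ.1 ⟨s, h⟩ else 0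
  have hφ : ∀ {s} (h : s ∈ P.boundedPart), φ s = ψ.1 ⟨s, h⟩ := fun h => dif_pos h
  have hφ1 : φ 1 = 1 := (hφ (one_mem _)).trans (map_one ψ.1)
  have hφadd : ∀ {s t}, s ∈ P.boundedPart → t ∈ P.boundedPart → φ (s + t) = φ s + φ t :=
    fun hs ht => by rw [hφ hs, hφ ht, hφ (add_mem hs ht), ← map_add]; rfl
  have hφmul : ∀ {s t}, s ∈ P.boundedPart → t ∈ P.boundedPart → φ (s * t) = φ s * φ t :=
    fun hs ht => by rw [hφ hs, hφ ht, hφ (mul_mem hs ht), ← map_mul]; rfl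
  have hφmono : ∀ {s t}, s ∈ P.boundedPart → t ∈ P.boundedPart → P.le s t → φ s ≤ φ t :=
    fun hs ht h => by rw [hφ hs, hφ ht]; exact ψ.2 _ _ h
  have hone : ∀ {s}, P.BddElem s → φ (1 + s) = (φ (1 + s) - 1) + 1 := fun {s} hs => by
    refine (tsub_add_cancel_of_le ?_).symm
    rw [← hφ1]
    exact hφmono (one_mem _) hs.one_add_mem (le_add_right _ _)
  refine ⟨fun s => φ (1 + s) - 1, ⟨by simp [hφ1], ?_, ?_, ?_, ?_⟩, fun s => ?_⟩
  · simp [hφadd (one_mem _) (one_mem _), hφ1]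
  · intro s t hs ht
    have h := hφadd hs.one_add_mem ht.one_add_mem
    have h' := hφadd (one_mem _) (hs.add ht).one_add_mem
    rw [show 1 + s + (1 + t) = 1 + (1 + (s + t)) by ring, h', hone (hs.add ht), hone hs, hone ht,
      hφ1] at h
    exact add_left_cancel (a := 2) (by linear_combination h)
  · intro s t hs ht
    have h := hφmul hs.one_add_mem ht.one_add_mem
    have h₁ := hφadd (mul_mem hs.one_add_mem ht.one_add_mem) (one_mem _)
    have h₂ := hφadd (add_mem hs.one_add_mem ht.one_add_mem) (hs.mul ht).one_add_mem
    have h₃ := hφadd hs.one_add_mem ht.one_add_mem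
    have h₄ := hφadd (add_mem (mul_mem hs.one_add_mem ht.one_add_mem) (one_mem _)) (one_mem _)
    -- A subtraction-free identity all of whose summands lie in the bounded part.
    rw [show (1 + s) * (1 + t) + 1 + 1 = 1 + s + (1 + t) + (1 + s * t) by ring, h₂, h₃, h₁, h,
      hone (hs.mul ht), hone hs, hone ht, hφ1] at h₄
    generalize φ (1 + s) - 1 = a at *
    generalize φ (1 + t) - 1 = b at *
    generalize φ (1 + s * t) - 1 = c at *
    exact add_left_cancel (a := a + b + 3) (by linear_combination h₄)
  · intro s t hst ht
    refine tsub_le_tsub_right (hφmono (ht.mono hst).one_add_mem ht.one_add_mem ?_) _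
    exact add_le_add le_rfl hst
  · simp [hφadd (one_mem _) s.2, hφ1, hφ s.2]

/-- Localization at `v`: `f s = g (s * v ^ k) / g v ^ k` does not depend on the exponent `k` that
makes `s * v ^ k` bounded above. -/
theorem IsBddHom.exists_spectrum {g : S → ℝ≥0} (hg : P.IsBddHom g) {v : S} (hv : P.BddElem v)
    (hk : ∀ s : S, ∃ k : ℕ, P.BddElem (s * v ^ k)) (h0 : g v ≠ 0) :
    ∃ f : P.Spectrum, ∀ s, P.BddElem s → P.ev s f = g s := by
  choose k hk using hk
  let f : S → ℝ≥0 := fun s => g (s * v ^ k s) / g v ^ k s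
  have hf : ∀ {s : S} {l : ℕ}, P.BddElem (s * v ^ l) → f s = g (s * v ^ l) / g v ^ l := by
    intro s l hl
    rw [div_eq_div_iff (pow_ne_zero _ h0) (pow_ne_zero _ h0), ← hg.map_pow hv, ← hg.map_pow hv,
      ← hg.map_mul _ _ (hk s) (hv.pow l), ← hg.map_mul _ _ hl (hv.pow _), mul_right_comm]
  have hadd : ∀ {s : S} {l : ℕ}, P.BddElem (s * v ^ l) → ∀ j, P.BddElem (s * v ^ (l + j)) :=
    fun h j => by rw [pow_add, ← mul_assoc]; exact h.mul (hv.pow j)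
  have hf' : ∀ {s}, P.BddElem s → f s = g s := fun {s} hs => by
    rw [hf (l := 0) (by simpa using hs)]; simp
  refine ⟨⟨{ toFun := f, map_one' := by rw [hf' .one, hg.map_one],
             map_zero' := by rw [hf' .zero, hg.map_zero],
             map_add' := ?_, map_mul' := ?_ }, fun s t hst => ?_⟩,
    fun s hs => hf' hs⟩
  · intro s t
    have he : s * t * v ^ (k s + k t) = (s * v ^ k s) * (t * v ^ k t) := by ring
    have hst : P.BddElem (s * t * v ^ (k s + k t)) := by rw [he]; exact (hk s).mul (hk t)
    change f (s * t) = f s * f t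
    rw [hf hst, he, hg.map_mul _ _ (hk s) (hk t), pow_add, mul_div_mul_comm]
  · intro s t
    change f (s + t) = f s + f t
    have hs := hadd (hk s) (k t)
    have ht := hadd (hk t) (k s)
    rw [add_comm] at ht
    have hst : P.BddElem ((s + t) * v ^ (k s + k t)) := by rw [add_mul]; exact hs.add ht
    rw [hf hst, hf hs, hf ht, add_mul, hg.map_add _ _ hs ht, add_div]
  · have hle := P.mul_right _ _ (v ^ k t) hst
    change f s ≤ f t
    rw [hf ((hk t).mono hle), hf (hk t)]
    exact div_le_div_of_nonneg_right (hg.mono _ _ hle (hk t)) bot_le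

end Extension

/-! ### Comparing `S` with its bounded part by means of an almost inverse. -/

section Comparison

variable {S : Type*} [CommSemiring S] {P : SemiringPreorder S}

theorem le_of_forall_natCast_mul_le {X Y : ℝ} (hX : 0 ≤ X)
    (h : ∀ e : ℕ, (e : ℝ) * e * Y ≤ (e + 1) * (e + 1) * X) : Y ≤ X := by
  by_contra! hlt
  obtain ⟨n, hn⟩ := exists_nat_gt (3 * X / (Y - X))
  rw [div_lt_iff₀ (sub_pos.2 hlt)] at hn
  have h1 := h (n + 1)
  push_cast at h1
  nlinarith [mul_nonneg (Nat.cast_nonneg (α := ℝ) n) hX,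
    mul_pos (Nat.cast_add_one_pos (α := ℝ) n) (sub_pos.2 hlt),
    mul_le_mul_of_nonneg_left hn.le (Nat.cast_nonneg (α := ℝ) n)]

/-- `v` is inverse to `U` up to positive rational factors, where the powers of `U ≽ 1` dominate
all elements. -/
structure IsAlmostInverse (P : SemiringPreorder S) (U v : S) (n : ℕ) : Prop where
  one_le : P.le 1 U
  le_pow : ∀ s, ∃ k : ℕ, P.le s (U ^ k)
  one_le_pow_mul : ∀ s, s ≠ 0 → ∃ k : ℕ, P.le 1 (U ^ k * s)
  one_le_mul : P.le 1 ((n : S) * v * U)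
  mul_le : P.le (v * U) n

theorem restrict_le {S₀ : Subsemiring S} {a b : S₀} :
    (P.restrict S₀).le a b ↔ P.le (a : S) b := Iff.rfl

namespace IsAlmostInverse

variable {U v : S} {n : ℕ} (hU : P.IsAlmostInverse U v n)
include hU

theorem le_natCast : P.le v n := by
  simpa using le_trans' (mul_le_mul_left v hU.one_le) hU.mul_le

theorem bddElem : P.BddElem v := ⟨n, hU.le_natCast⟩

theorem bddElem_mul_pow {s : S} {k : ℕ} (hs : P.le s (U ^ k)) : P.BddElem (s * v ^ k) := by
  refine BddElem.mono (P.mul_right _ _ (v ^ k) hs) ?_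
  rw [← mul_pow, mul_comm]
  exact BddElem.pow ⟨n, hU.mul_le⟩ k

theorem mul_ne_zero (hp : P.IsProper) {s t : S} (hs : s ≠ 0) (ht : t ≠ 0) : s * t ≠ 0 := fun h => by
  obtain ⟨k, hk⟩ := hU.one_le_pow_mul s hs
  obtain ⟨l, hl⟩ := hU.one_le_pow_mul t ht
  refine hp.not_one_le_zero ?_
  have := mul_le_mul hk hl
  rwa [mul_mul_mul_comm, h, mul_zero, mul_one] at this

theorem pow_ne_zero (hp : P.IsProper) {s : S} (hs : s ≠ 0) (k : ℕ) : s ^ k ≠ 0 := by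
  induction k with
  | zero =>
    rw [pow_zero]
    exact fun h => hp.not_one_le_zero (le_of_eq h)
  | succ k ih => rw [pow_succ]; exact hU.mul_ne_zero hp ih hs

theorem exists_bddHom (ψ : (P.restrict P.boundedPart).Spectrum) :
    ∃ g : S → ℝ≥0, P.IsBddHom g ∧ (∀ s : P.boundedPart, g s = ψ.1 s) ∧
      (g v = 0 ∨ ∃ f : P.Spectrum, ∀ s, P.BddElem s → P.ev s f = g s) := by
  obtain ⟨g, hg, hgψ⟩ := exists_isBddHom ψ
  refine ⟨g, hg, hgψ, or_iff_not_imp_left.2 (hg.exists_spectrum hU.bddElem fun s => ?_)⟩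
  exact (hU.le_pow s).imp fun k hk => hU.bddElem_mul_pow hk

theorem pow_le_of_mul_le {z a b : S} (hz : z ≠ 0) (h : P.le (z * a) (z * b)) :
    ∃ L : ℕ, ∀ i : ℕ, P.le (a ^ i) (U ^ L * b ^ i) := by
  obtain ⟨k, hk⟩ := hU.one_le_pow_mul z hz
  obtain ⟨l, hl⟩ := hU.le_pow z
  refine ⟨k + l, fun i => ?_⟩
  calc P.le (a ^ i) (1 * a ^ i) := le_of_eq (by ring)
    P.le _ (U ^ k * z * a ^ i) := mul_le_mul hk le_rfl
    P.le _ (U ^ k * (z * a ^ i)) := le_of_eq (by ring)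
    P.le _ (U ^ k * (z * b ^ i)) := mul_le_mul_left _ (mul_pow_le_mul_pow h i)
    P.le _ (U ^ k * (U ^ l * b ^ i)) := mul_le_mul_left _ (mul_le_mul hl le_rfl)
    P.le _ (U ^ (k + l) * b ^ i) := le_of_eq (by ring)

/-- A point of `Δ(S₀)` need not extend to `S`. But `1 + m * v ^ (j + 1) ≤ 1 + C * v ^ (j + 1)` holds
on the spectrum of the bounded part: where `v` vanishes both sides are 1, and the other points come
from `Δ(S)`. Strassen's theorem and powers replace the catalyst by a constant, so the resulting
inequality involves only elements of `S₀` and `f₀` can be applied. In the limit the constants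
disappear, and `f₀ v > 0` cancels. -/
theorem ev_restrict_le (hp : P.IsProper) {S₀ : Subsemiring S} (hv : v ∈ S₀)
    (hv' : ∃ w ∈ S₀, ∃ k : ℕ, P.le 1 ((k : S) * w * v)) {m : S} (hm : m ∈ S₀) {C : ℕ}
    (h : ∀ f : P.Spectrum, P.ev m f ≤ C) (f₀ : (P.restrict S₀).Spectrum) :
    f₀.1 ⟨m, hm⟩ ≤ C := by
  obtain ⟨j, hj⟩ := hU.le_pow m
  have hmv : P.BddElem (m * v ^ j) := hU.bddElem_mul_pow hj
  have hb : P.BddElem (m * v ^ j * v) := hmv.mul hU.bddElem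
  have hb' : P.BddElem ((C : S) * v ^ j * v) :=
    ((BddElem.natCast C).mul (hU.bddElem.pow j)).mul hU.bddElem
  have hne : (⟨_, hb'.one_add_mem⟩ : P.boundedPart) ≠ 0 := fun h0 => by
    refine hp.not_one_le_zero (le_trans' (le_add_right 1 ((C : S) * v ^ j * v)) (le_of_eq ?_))
    exact congrArg Subtype.val h0
  have hle : ∀ ψ : (P.restrict P.boundedPart).Spectrum,
      (P.restrict P.boundedPart).ev ⟨_, hb.one_add_mem⟩ ψ ≤
        (P.restrict P.boundedPart).ev ⟨_, hb'.one_add_mem⟩ ψ := fun ψ => by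
    obtain ⟨g, hg, hgψ, hgf⟩ := hU.exists_bddHom ψ
    change ψ.1 _ ≤ ψ.1 _
    rw [← hgψ, ← hgψ]
    change g (1 + m * v ^ j * v) ≤ g (1 + C * v ^ j * v)
    rw [hg.map_add _ _ .one hb, hg.map_add _ _ .one hb', hg.map_mul _ _ hmv hU.bddElem,
      hg.map_mul _ _ ((BddElem.natCast C).mul (hU.bddElem.pow j)) hU.bddElem]
    rcases hgf with h0 | ⟨f, hf⟩
    · simp [h0]
    · rw [← hf _ hmv, ← hf _ ((BddElem.natCast C).mul (hU.bddElem.pow j))]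
      simp only [ev, map_mul, map_natCast]
      have := h f
      simp only [ev] at this
      gcongr
  obtain ⟨w, hw, k, hk⟩ := hv'
  have hpos : 0 < f₀.1 ⟨v, hv⟩ := pos_iff_ne_zero.2 fun h0 => by
    have := f₀.2 1 ((k : S₀) * ⟨w, hw⟩ * ⟨v, hv⟩)
      (restrict_le.2 (by push_cast; exact hk))
    rw [map_one, map_mul, h0, mul_zero] at this
    exact absurd this (by simp)
  have key : 1 + f₀.1 ⟨m, hm⟩ * f₀.1 ⟨v, hv⟩ ^ j * f₀.1 ⟨v, hv⟩ ≤
      1 + (C : ℝ≥0) * f₀.1 ⟨v, hv⟩ ^ j * f₀.1 ⟨v, hv⟩ := by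
    rw [← NNReal.coe_le_coe]
    refine le_of_forall_natCast_mul_le (NNReal.coe_nonneg _) fun e => ?_
    obtain ⟨z, hz, hzle⟩ := (hp.restrict P.boundedPart).exists_mul_le_of_ev_le
      isBounded_boundedPart hne hle e
    obtain ⟨K, hK⟩ := isBounded_boundedPart.pow_le_of_mul_le hz hzle
    refine le_of_forall_pow_le_mul_pow (K := K) (by positivity) fun i => ?_
    have hKi := restrict_le.1 (hK i)
    push_cast at hKi
    have := f₀.2 (((e : S₀) * e * (1 + ⟨m, hm⟩ * ⟨v, hv⟩ ^ j * ⟨v, hv⟩)) ^ i)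
      ((K : S₀) * (((e : S₀) + 1) * (e + 1) * (1 + (C : S₀) * ⟨v, hv⟩ ^ j * ⟨v, hv⟩)) ^ i)
      (restrict_le.2 (by push_cast; exact hKi))
    simp only [map_mul, map_pow, map_add, map_natCast, map_one] at this
    exact_mod_cast this
  rw [add_le_add_iff_left, mul_assoc, mul_assoc] at key
  exact le_of_mul_le_mul_right key (by positivity)

/-- On the bounded part, `(m * x) ^ N + (m * y) ^ N * v` is compared with `(1 + n) * (m * x) ^ N`;
points killing `v` cause no trouble. Multiplying by `n * U` undoes `v`. Only `L`, the cost of the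
catalyst, depends on `N`. -/
theorem exists_pow_mul_le (hp : P.IsProper) {x y m : S} {a : ℕ}
    (hm : P.le 1 ((a : S) * m * x)) (hm' : P.le (m * x) a) (hy : P.BddElem (m * y))
    (h : ∀ f : P.Spectrum, P.ev y f ≤ P.ev x f) :
    ∃ H : ℕ, ∀ N : ℕ, ∃ L : ℕ, ∀ i : ℕ,
      P.le (y ^ (N * i)) (U ^ (L + H * i) * x ^ (N * i)) := by
  have hm0 : m ≠ 0 := fun h0 => hp.not_one_le_zero (by simpa [h0] using hm)
  -- The factor 4 is `(e + 1)²` at `e = 1`, `1 + n` comes from the comparison, and `n * U` from `1 ≼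
  -- n * v * U`.
  obtain ⟨H, hH⟩ := hU.le_pow ((4 * (1 + n) * n : ℕ) * U)
  refine ⟨H, fun N => ?_⟩
  have hmx : m * x ∈ P.boundedPart := .inr ⟨a, by rwa [← mul_assoc], hm'⟩
  have hx1 : (m * x) ^ N ∈ P.boundedPart := pow_mem hmx N
  have hx2 : (((1 + n : ℕ) : S)) * (m * x) ^ N ∈ P.boundedPart := mul_mem (natCast_mem _ _) hx1
  have hxb := bddElem_of_mem hmx
  have hy1 : P.BddElem ((m * y) ^ N * v) := (hy.pow N).mul hU.bddElem
  -- The summand `(m * x) ^ N` provides the positive lower bound.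
  have hy2 : (m * x) ^ N + (m * y) ^ N * v ∈ P.boundedPart := by
    obtain ⟨c, hc⟩ := (bddElem_of_mem hx1).add hy1
    refine .inr ⟨a ^ N + c, ?_, le_trans' hc (cast_le_cast (by omega))⟩
    have h1 := one_le_pow hm N
    refine le_trans' h1 ?_
    refine le_trans' (le_add_right _
      ((c : S) * (m * x) ^ N + ((a : S) ^ N + c) * ((m * y) ^ N * v))) (le_of_eq ?_)
    push_cast; ring
  have hne : (⟨_, hx2⟩ : P.boundedPart) ≠ 0 := fun h0 => by
    have h0' : ((1 + n : ℕ) : S) * (m * x) ^ N = 0 := congrArg Subtype.val h0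
    refine hp.not_one_le_zero ?_
    calc P.le 1 ((a * m * x) ^ N) := one_le_pow hm N
      P.le _ ((a * m * x) ^ N + n * (a * m * x) ^ N) := le_add_right _ _
      P.le _ (a ^ N * (((1 + n : ℕ) : S) * (m * x) ^ N)) := le_of_eq (by push_cast; ring)
      P.le _ 0 := le_of_eq (by rw [h0', mul_zero])
  have hle : ∀ ψ : (P.restrict P.boundedPart).Spectrum,
      (P.restrict P.boundedPart).ev ⟨_, hy2⟩ ψ ≤
        (P.restrict P.boundedPart).ev ⟨_, hx2⟩ ψ := fun ψ => by
    obtain ⟨g, hg, hgψ, hgf⟩ := hU.exists_bddHom ψ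
    change ψ.1 _ ≤ ψ.1 _
    rw [← hgψ, ← hgψ]
    change g ((m * x) ^ N + (m * y) ^ N * v) ≤ g ((1 + n : ℕ) * (m * x) ^ N)
    have hgv : g v ≤ n := by
      rw [← hg.map_natCast]
      exact hg.mono _ _ hU.le_natCast (.natCast n)
    rw [hg.map_add _ _ (hxb.pow N) hy1, hg.map_mul _ _ (hy.pow N) hU.bddElem,
      hg.map_mul _ _ (.natCast _) (hxb.pow N), hg.map_natCast, hg.map_pow hxb, hg.map_pow hy]
    push_cast
    rw [add_mul, one_mul]
    refine _root_.add_le_add _root_.le_rfl ?_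
    rcases hgf with h0 | ⟨f, hf⟩
    · simp [h0]
    · rw [mul_comm]
      gcongr
      rw [← hf _ hxb, ← hf _ hy]
      simp only [ev, map_mul]
      have := h f
      simp only [ev] at this
      gcongr
  obtain ⟨z, hz, hzle⟩ := (hp.restrict P.boundedPart).exists_mul_le_of_ev_le
    isBounded_boundedPart hne hle 1
  have hz' : (z : S) ≠ 0 := fun h0 => hz (Subtype.ext h0)
  have hzle' : P.le ((z : S) * (((1 : ℕ) : S) * ((1 : ℕ) : S) * ((m * x) ^ N + (m * y) ^ N * v)))
    ((z : S) * ((((1 : ℕ) : S) + 1) * (((1 : ℕ) : S) + 1) * ((1 + n : ℕ) * (m * x) ^ N))) := hzle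
  have key : P.le ((z : S) * m ^ N * y ^ N) (z * m ^ N * (U ^ H * x ^ N)) := by
    calc P.le ((z : S) * m ^ N * y ^ N) (z * m ^ N * y ^ N * 1) := le_of_eq (by ring)
      P.le _ (z * m ^ N * y ^ N * (n * v * U)) := mul_le_mul_left _ hU.one_le_mul
      P.le _ (z * m ^ N * y ^ N * (n * v * U) + n * U * (z * (m * x) ^ N)) := le_add_right _ _
      P.le _ (n * U * (z * (((1 : ℕ) : S) * ((1 : ℕ) : S) * ((m * x) ^ N + (m * y) ^ N * v)))) :=
        le_of_eq (by push_cast; ring)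
      P.le _ (n * U * ((z : S) * ((((1 : ℕ) : S) + 1) * (((1 : ℕ) : S) + 1) *
          ((1 + n : ℕ) * (m * x) ^ N)))) := mul_le_mul_left _ hzle'
      P.le _ (z * m ^ N * x ^ N * ((4 * (1 + n) * n : ℕ) * U)) := le_of_eq (by push_cast; ring)
      P.le _ (z * m ^ N * x ^ N * U ^ H) := mul_le_mul_left _ hH
      P.le _ (z * m ^ N * (U ^ H * x ^ N)) := le_of_eq (by ring)
  obtain ⟨L, hL⟩ := hU.pow_le_of_mul_le (hU.mul_ne_zero hp hz' (hU.pow_ne_zero hp hm0 N)) key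
  refine ⟨L, fun i => ?_⟩
  convert hL i using 1 <;> ring

/-- Divide `i` by `N`; the remainder is below `N`, so its cost is bounded uniformly in `i`. -/
theorem exists_pow_le {x y : S} (hx : x ≠ 0) {H N L : ℕ} (hN : 0 < N)
    (h : ∀ i : ℕ, P.le (y ^ (N * i)) (U ^ (L + H * i) * x ^ (N * i))) :
    ∃ L' : ℕ, ∀ i : ℕ, P.le (y ^ i) (U ^ (L' + H * (i / N)) * x ^ i) := by
  obtain ⟨b, hb⟩ := hU.le_pow y
  obtain ⟨c, hc⟩ := hU.one_le_pow_mul x hx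
  have hyx : P.le y (U ^ (b + c) * x) := by
    calc P.le y (U ^ b) := hb
      P.le _ (U ^ b * 1) := le_of_eq (by ring)
      P.le _ (U ^ b * (U ^ c * x)) := mul_le_mul_left _ hc
      P.le _ (U ^ (b + c) * x) := le_of_eq (by ring)
  refine ⟨L + (b + c) * N, fun i => ?_⟩
  have hr : P.le (U ^ ((b + c) * (i % N))) (U ^ ((b + c) * N)) :=
    pow_le_pow_right hU.one_le (Nat.mul_le_mul_left _ (Nat.mod_lt _ hN).le)
  calc P.le (y ^ i) (y ^ (N * (i / N)) * y ^ (i % N)) :=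
        le_of_eq (by rw [← pow_add, Nat.div_add_mod])
    P.le _ (U ^ (L + H * (i / N)) * x ^ (N * (i / N)) * (U ^ (b + c) * x) ^ (i % N)) :=
        mul_le_mul (h _) (pow_le_pow hyx _)
    P.le _ (U ^ (L + H * (i / N)) * x ^ (N * (i / N) + i % N) * U ^ ((b + c) * (i % N))) :=
        le_of_eq (by rw [mul_pow, pow_add x, pow_mul U (b + c)]; ring)
    P.le _ (U ^ (L + H * (i / N)) * x ^ (N * (i / N) + i % N) * U ^ ((b + c) * N)) :=
        mul_le_mul_left _ hr
    P.le _ (U ^ (L + (b + c) * N + H * (i / N)) * x ^ i) :=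
        le_of_eq (by rw [Nat.div_add_mod]; ring)

/-- The least admissible exponent is at most `L + H * (i / N)` for every positive `N`, with `L`
depending on `N`. Its ratio to `i` thus has upper limit at most `H / N`. -/
theorem exists_tendsto {x y : S} (hx : x ≠ 0) {H : ℕ}
    (h : ∀ N : ℕ, ∃ L : ℕ, ∀ i : ℕ, P.le (y ^ (N * i)) (U ^ (L + H * i) * x ^ (N * i))) :
    ∃ k : ℕ → ℕ, Filter.Tendsto (fun i : ℕ => (k i : ℝ) / (i : ℝ)) Filter.atTop (nhds 0) ∧
      ∀ i : ℕ, P.le (y ^ i) (U ^ k i * x ^ i) := by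
  classical
  have h' : ∀ N : ℕ, 0 < N → ∃ L : ℕ, ∀ i : ℕ,
      P.le (y ^ i) (U ^ (L + H * (i / N)) * x ^ i) := fun N hN => by
    obtain ⟨L, hL⟩ := h N
    exact hU.exists_pow_le hx hN hL
  have hex : ∀ i : ℕ, ∃ k : ℕ, P.le (y ^ i) (U ^ k * x ^ i) := fun i =>
    ⟨_, (h' 1 one_pos).choose_spec i⟩
  refine ⟨fun i => Nat.find (hex i), ?_, fun i => Nat.find_spec (hex i)⟩
  rw [Metric.tendsto_atTop]
  intro ε hε
  obtain ⟨N, hN⟩ := exists_nat_gt (2 * H / ε)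
  have hN0 : 0 < N + 1 := N.succ_pos
  obtain ⟨L, hL⟩ := h' (N + 1) hN0
  obtain ⟨i₀, hi₀⟩ := exists_nat_gt (2 * L / ε)
  refine ⟨i₀ + 1, fun i hi => ?_⟩
  have hipos : (0 : ℝ) < i := by exact_mod_cast (Nat.succ_pos _).trans_le hi
  rw [Real.dist_eq, sub_zero, abs_of_nonneg (by positivity), div_lt_iff₀ hipos]
  have hfind : ((Nat.find (hex i) : ℕ) : ℝ) ≤ L + H * ((i / (N + 1) : ℕ) : ℝ) := by
    exact_mod_cast Nat.find_min' (hex i) (hL i)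
  have hdiv : ((i / (N + 1) : ℕ) : ℝ) ≤ i / ((N + 1 : ℕ) : ℝ) := Nat.cast_div_le
  have h1 : (H : ℝ) * (i / ((N + 1 : ℕ) : ℝ)) ≤ ε / 2 * i := by
    rw [mul_div_assoc', div_le_iff₀ (by positivity)]
    rw [div_lt_iff₀ hε] at hN
    push_cast
    nlinarith [mul_pos hε hipos, mul_le_mul_of_nonneg_right hN.le hipos.le]
  have h2 : (L : ℝ) < ε / 2 * i := by
    rw [div_lt_iff₀ hε] at hi₀
    have : (i₀ : ℝ) + 1 ≤ i := by exact_mod_cast hi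
    nlinarith
  have h3 := mul_le_mul_of_nonneg_left hdiv (Nat.cast_nonneg (α := ℝ) H)
  linarith

end IsAlmostInverse

/-- Apply `f`, take logarithms and divide by `n`; the case `f x = 0`, where logarithms fail, is
settled by `n = 1`. -/
theorem AsymptoticGE.ev_le {u x y : S} (h : P.AsymptoticGE u x y) (f : P.Spectrum) :
    P.ev y f ≤ P.ev x f := by
  obtain ⟨k, hk, hle⟩ := h
  have hle' : ∀ n : ℕ, (P.ev y f : ℝ) ^ n ≤ (P.ev u f : ℝ) ^ k n * (P.ev x f : ℝ) ^ n := fun n => by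
    have := f.2 _ _ (hle n)
    simp only [map_mul, map_pow] at this
    exact_mod_cast this
  by_contra! hlt
  rcases eq_zero_or_pos (P.ev x f) with h0 | h0
  · have := hle' 1
    rw [h0] at this hlt
    simp only [pow_one, NNReal.coe_zero, mul_zero] at this
    exact absurd hlt (not_lt.2 (by exact_mod_cast this))
  have hx : (0 : ℝ) < P.ev x f := NNReal.coe_pos.2 h0
  have hr : 1 < (P.ev y f : ℝ) / P.ev x f := (one_lt_div hx).2 (NNReal.coe_lt_coe.2 hlt)
  refine absurd (Real.log_pos hr) (not_lt.2 ?_)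
  have ht := hk.mul_const (Real.log (P.ev u f))
  rw [zero_mul] at ht
  refine ge_of_tendsto ht (Filter.eventually_atTop.2 ⟨1, fun n hn => ?_⟩)
  have hn' : (0 : ℝ) < n := by exact_mod_cast hn
  have h1 : ((P.ev y f : ℝ) / P.ev x f) ^ n ≤ (P.ev u f : ℝ) ^ k n := by
    rw [div_pow, div_le_iff₀ (by positivity)]
    exact hle' n
  have h2 := Real.log_le_log (by positivity) h1
  rw [Real.log_pow, Real.log_pow] at h2
  rw [div_mul_eq_mul_div, le_div_iff₀ hn']
  linarith

end Comparison

/-! ### Using (M1) and (M2). -/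

section Generating

variable {S : Type*} [CommSemiring S] {P : SemiringPreorder S} {M : Set S}
  (hM1 : ∀ s : S, s ≠ 0 → ∃ m ∈ M, ∃ n : ℕ, P.le 1 ((n : S) * m * s) ∧ P.le (m * s) (n : S))
  (hM2 : ∀ (m : S) (hm : m ∈ M),
    BddAbove (Set.range
      ((P.restrict (Subsemiring.closure M)).ev ⟨m, Subsemiring.subset_closure hm⟩)) →
    ∃ n : ℕ, P.le m (n : S))
include hM1

theorem IsPowerUniversal.exists_isAlmostInverse (hp : P.IsProper) {u : S}
    (hu : P.IsPowerUniversal u) : ∃ v ∈ M, ∃ n : ℕ, P.IsAlmostInverse (1 + u) v n := by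
  have hu' : P.le u (1 + u) := le_add_left _ _
  obtain ⟨v, hv, n, h1, h2⟩ := hM1 (1 + u) fun h0 =>
    hp.not_one_le_zero (h0 ▸ le_add_right 1 u)
  refine ⟨v, hv, n, le_add_right _ _, fun s => ?_, fun s hs => ?_, h1, h2⟩
  · by_cases hs : s = 0
    · exact ⟨0, by simpa [hs] using P.zero_le_one⟩
    · exact (hu s hs).imp fun k hk => le_trans' hk.2 (pow_le_pow hu' k)
  · exact (hu s hs).imp fun k hk => le_trans' hk.1 (P.mul_right _ _ _ (pow_le_pow hu' k))

include hM2

/-- Applying (M1) twice gives `a ∈ M` almost inverse to `s` and `b ∈ M` almost inverse to `a`. Then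
`b` is bounded by a multiple of `s` on `Δ(S)`, hence bounded on `Δ(S₀)`, and (M2) applies to it;
finally `s ≼ j * b * (a * s)`. -/
theorem bddElem_of_forall_ev_le (hp : P.IsProper) {u : S} (hu : P.IsPowerUniversal u) {s : S}
    {C : ℕ} (h : ∀ f : P.Spectrum, P.ev s f ≤ C) : P.BddElem s := by
  by_cases hs : s = 0
  · exact hs ▸ BddElem.zero
  obtain ⟨v, hv, n, hU⟩ := hu.exists_isAlmostInverse hM1 hp
  have hv0 : v ≠ 0 := fun h0 => hp.not_one_le_zero (by simpa [h0] using hU.one_le_mul)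
  obtain ⟨w, hw, k, hk, -⟩ := hM1 v hv0
  obtain ⟨a, ha, i, hi, hi'⟩ := hM1 s hs
  obtain ⟨b, hb, j, hj, hj'⟩ := hM1 a fun h0 => hp.not_one_le_zero (by simpa [h0] using hi)
  have hbs : P.le b ((i * j : ℕ) * s) := by
    calc P.le b (b * 1) := le_of_eq (by ring)
      P.le _ (b * (i * a * s)) := mul_le_mul_left _ hi
      P.le _ ((i * s) * (b * a)) := le_of_eq (by ring)
      P.le _ ((i * s) * j) := mul_le_mul_left _ hj'
      P.le _ ((i * j : ℕ) * s) := le_of_eq (by push_cast; ring)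
  have hbC : ∀ f : P.Spectrum, P.ev b f ≤ (i * j * C : ℕ) := fun f => by
    have h1 := f.2 _ _ hbs
    rw [map_mul, map_natCast] at h1
    refine h1.trans ?_
    push_cast
    have := h f
    simp only [ev] at this
    gcongr
  have hbdd : P.BddElem b := hM2 b hb ⟨(i * j * C : ℕ), by
    rintro _ ⟨f₀, rfl⟩
    exact hU.ev_restrict_le hp (Subsemiring.subset_closure hv)
      ⟨w, Subsemiring.subset_closure hw, k, hk⟩ (Subsemiring.subset_closure hb) hbC f₀⟩
  refine BddElem.mono (t := ((j : S) * b) * (a * s)) ?_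
    (((BddElem.natCast j).mul hbdd).mul ⟨i, hi'⟩)
  calc P.le s (s * 1) := le_of_eq (by ring)
    P.le _ (s * (j * b * a)) := mul_le_mul_left _ hj
    P.le _ (((j : S) * b) * (a * s)) := le_of_eq (by ring)

/-- If `Δ(S)` were empty, `U` would vacuously be bounded on it, hence dominated by an integer. Then
`1 ≼ n * v * U` prevents a point of the bounded part from killing `v`, so that point comes from
`Δ(S)`. -/
theorem nonempty_spectrum_of_generating (hp : P.IsProper) {u : S} (hu : P.IsPowerUniversal u) :
    Nonempty P.Spectrum := by
  by_contra hempty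
  obtain ⟨v, hv, n, hU⟩ := hu.exists_isAlmostInverse hM1 hp
  have hbU : P.BddElem (1 + u) :=
    bddElem_of_forall_ev_le hM1 hM2 hp hu (C := 0) fun f => absurd ⟨f⟩ hempty
  obtain ⟨ψ⟩ := (hp.restrict P.boundedPart).nonempty_spectrum isBounded_boundedPart
  obtain ⟨g, hg, -, h0 | ⟨f, -⟩⟩ := hU.exists_bddHom ψ
  · have hnv : P.BddElem ((n : S) * v) := (BddElem.natCast n).mul hU.bddElem
    have := hg.mono _ _ hU.one_le_mul (hnv.mul hbU)
    rw [hg.map_one, hg.map_mul _ _ hnv hbU, hg.map_mul _ _ (.natCast n) hU.bddElem, h0,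
      mul_zero, zero_mul] at this
    exact absurd this (by simp)
  · exact hempty ⟨f⟩

theorem asymptoticGE_of_forall_ev_le (hp : P.IsProper) {u : S} (hu : P.IsPowerUniversal u)
    {x y : S} (h : ∀ f : P.Spectrum, P.ev y f ≤ P.ev x f) : P.AsymptoticGE u x y := by
  by_cases hy : y = 0
  · refine ⟨fun _ => 0, by simp, fun n => ?_⟩
    rcases n.eq_zero_or_pos with rfl | hn
    · simpa using le_rfl
    · rw [hy, zero_pow hn.ne']
      exact zero_le _
  obtain ⟨v, hv, n, hU⟩ := hu.exists_isAlmostInverse hM1 hp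
  -- Every `f` is positive at the nonzero `y`; a point of `Δ(S)` is needed to conclude.
  have hx : x ≠ 0 := fun hx => by
    obtain ⟨f⟩ := nonempty_spectrum_of_generating hM1 hM2 hp hu
    obtain ⟨m, -, k, hk, -⟩ := hM1 y hy
    have h1 := f.2 _ _ hk
    have h2 := h f
    simp only [ev, hx, map_zero, nonpos_iff_eq_zero] at h2
    rw [map_one, map_mul, h2, mul_zero] at h1
    exact absurd h1 (by simp)
  obtain ⟨m, -, a, hm, hm'⟩ := hM1 x hx
  have hmy : P.BddElem (m * y) := by
    refine bddElem_of_forall_ev_le hM1 hM2 hp hu (C := a) fun f => ?_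
    have h1 := f.2 _ _ hm'
    have h2 := h f
    simp only [map_mul, map_natCast, ev] at h1 h2 ⊢
    exact (mul_le_mul_right h2 _).trans h1
  obtain ⟨H, hH⟩ := hU.exists_pow_mul_le hp hm hm' hmy h
  obtain ⟨k, hk, hle⟩ := hU.exists_tendsto hx hH
  -- Returning from `1 + u` to `u` multiplies the exponents by the constant `l`.
  obtain ⟨l, -, hl⟩ := hu (1 + u) fun h0 => hp.not_one_le_zero (h0 ▸ le_add_right 1 u)
  refine ⟨fun i => l * k i, ?_, fun i => le_trans' (hle i) (P.mul_right _ _ _ ?_)⟩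
  · have := hk.const_mul (l : ℝ)
    rw [mul_zero] at this
    refine this.congr fun i => ?_
    push_cast; ring
  · rw [pow_mul]
    exact pow_le_pow hl _

end Generating

end SemiringPreorder

theorem theorem2 {S : Type*} [CommSemiring S] (P : SemiringPreorder S)
    (hgrowth : P.PolynomialGrowth) (hnat : P.NatOrderEmbedding) (M : Set S)
    (hM1 : ∀ s : S, s ≠ 0 →
      ∃ m ∈ M, ∃ n : ℕ, P.le 1 ((n : S) * m * s) ∧ P.le (m * s) (n : S))
    (hM2 : ∀ (m : S) (hm : m ∈ M),
      BddAbove (Set.range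
        ((P.restrict (Subsemiring.closure M)).ev ⟨m, Subsemiring.subset_closure hm⟩)) →
      ∃ n : ℕ, P.le m (n : S)) :
    (∀ u : S, P.IsPowerUniversal u → ∀ x y : S,
      P.AsymptoticGE u x y ↔ ∀ f : P.Spectrum, P.ev y f ≤ P.ev x f) ∧
    Nonempty P.Spectrum ∧ LocallyCompactSpace P.Spectrum ∧ T2Space P.Spectrum ∧
    (∀ u : S, P.IsPowerUniversal u → IsProperMap (P.ev u)) := by
  obtain ⟨u, hu⟩ := hgrowth
  have hp := hnat.isProper
  exact ⟨fun w hw x y => ⟨fun h f => h.ev_le f,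
      SemiringPreorder.asymptoticGE_of_forall_ev_le hM1 hM2 hp hw⟩,
    SemiringPreorder.nonempty_spectrum_of_generating hM1 hM2 hp hu, hu.locallyCompactSpace,
    inferInstance, fun w hw => hw.isProperMap_ev⟩
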